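/- Let $\mathbf t=(t_1,t_2)$ with $t_1,t_2$ positive integers, $|\mathbf t|=t_1+t_2$, $D_0=(t_1x,t_2y)^T$. For $k\in\mathbb Z$ let $\mathscr P_k$ be the space of real polynomials spanned by the monomials $x^ay^b$ with $t_1a+t_2b=k$ (so $\mathscr P_k=\{0\}$ for $k<0$), and let $\mathcal Q_k$ be the space of polynomial vector fields $(P,Q)^T$ with $P\in\mathscr P_{k+t_1}$, $Q\in\mathscr P_{k+t_2}$. Write $X_g=(-\partial_y g,\partial_x g)^T$ and $U\wedge V=U_1V_2-U_2V_1$. Let $n\in\mathbb Z$ and let $F=\sum_{j\ge n}F_j$, $F_j\in\mathcal Q_j$, be a formal planar vector field. Put $h=\frac{1}{n+|\mathbf t|}D_0\wedge F_n$ and $\mu=\frac1{n+|\mathbf t|}\operatorname{div}F_n$, so that $F_n=X_h+\mu D_0$ (if $n+|\mathbf t|=0$ then $F_n=0$ and $h=\mu=0$). For each $m$ choose a complementary subspace $\Delta_m$ of $h\,\mathscr P_{m-n-|\mathbf t|}$ in $\mathscr P_m$, and let $\mathrm{Proj}_{\Delta_m}$ be the projection of $\mathscr P_m$ onto $\Delta_m$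 along $h\,\mathscr P_{m-n-|\mathbf t|}$. Consider the linear operators $$\ell_k:\mathscr P_{k-n}\to\mathscr P_k,\qquad \ell_k(p)=\nabla p\cdot F_n,$$ $$\ell^{c}_{m}:\Delta_{m-n}\to\Delta_m,\qquad \ell^{c}_{m}(g)=\mathrm{Proj}_{\Delta_m}\Big(\nabla g\cdot\big(F_n-\tfrac{n+|\mathbf t|}{m}\,\mu D_0\big)\Big),$$ and choose arbitrary complementary subspaces $\mathrm{Cor}(\ell_k)$ of $\mathrm{Range}(\ell_k)$ in $\mathscr P_k$ and $\mathrm{Cor}(\ell^c_m)$ of $\mathrm{Range}(\ell^c_m)$ in $\Delta_m$. (Only the operators $\ell^c_m$ with $m=n+k+|\mathbf t|$ and $\ell_{n+k}$, $k\ge1$, matter.) If $\mathrm{Ker}(\ell^{c}_{n+k+|\mathbf t|})=\{0\}$ for all integers $k\ge1$, then $F$ is formally orbitally equivalent to a formal vector field $$G=F_n+\sum_{j>n}G_j,\qquad G_j=X_{g_{j+|\mathbf t|}}+\eta_jD_0\in\mathcal Q_j,$$ with $g_{j+|\mathbf t|}\in\mathrm{Cor}(\ell^{c}_{j+|\mathbf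 t|})$ and $\eta_j\in\mathrm{Cor}(\ell_j)$ for all $j>n$. Here $F$ and $G$ are formally orbitally equivalent if there are a pair $\Phi$ of formal power series with $\Phi(0)=0$, $\det D\Phi(0)\ne0$, and a formal power series $u$ with $u(0)>0$, such that $D\Phi\cdot F=u\cdot(G\circ\Phi)$. -/

import Mathlib

open scoped MvPowerSeries.WithPiTopology

noncomputable section

namespace QHNormalForm

/-- Real polynomials in the two variables `x = X 0`, `y = X 1`. -/
abbrev Poly : Type := MvPolynomial (Fin 2) ℝ

/-- Planar polynomial vector fields. -/
abbrev PolyVF : Type := Fin 2 → Poly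

/-- Real formal power series in two variables. -/
abbrev Series : Type := MvPowerSeries (Fin 2) ℝ

/-- Planar formal vector fields. -/
abbrev FormalVF : Type := Fin 2 → Series

/-- `|t| = t₁ + t₂`. -/
def wt (t : Fin 2 → ℕ) : ℤ := (t 0 : ℤ) + (t 1 : ℤ)

/-- Quasi-homogeneous polynomials of type `t` and degree `k` (zero only, if `k < 0`):
the span of the monomials `x ^ a * y ^ b` with `t₁ * a + t₂ * b = k`. -/
def P (t : Fin 2 → ℕ) (k : ℤ) : Submodule ℝ Poly :=
  MvPolynomial.weightedHomogeneousSubmodule ℝ (fun i => (t i : ℤ)) k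

/-- Quasi-homogeneous polynomial vector fields of type `t` and degree `k`. -/
def Q (t : Fin 2 → ℕ) (k : ℤ) : Submodule ℝ PolyVF :=
  Submodule.pi Set.univ (fun i => P t (k + (t i : ℤ)))

/-- The Euler-type field `D₀ = (t₁ x, t₂ y)`. -/
def D0 (t : Fin 2 → ℕ) : PolyVF := fun i => MvPolynomial.C (t i : ℝ) * MvPolynomial.X i

/-- The Hamiltonian field `X_g = (-∂g/∂y, ∂g/∂x)`. -/
def ham (g : Poly) : PolyVF := ![-MvPolynomial.pderiv 1 g, MvPolynomial.pderiv 0 g]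

/-- The wedge product `U ∧ V = U₁ V₂ - U₂ V₁`. -/
def wedge (U V : PolyVF) : Poly := U 0 * V 1 - U 1 * V 0

/-- The divergence. -/
def divergence (V : PolyVF) : Poly := MvPolynomial.pderiv 0 (V 0) + MvPolynomial.pderiv 1 (V 1)

/-- The derivative along a field, `p ↦ ∇p · V`. -/
def lieD (V : PolyVF) : Poly →ₗ[ℝ] Poly where
  toFun p := MvPolynomial.pderiv 0 p * V 0 + MvPolynomial.pderiv 1 p * V 1
  map_add' p q := by simp only [map_add]; ring
  map_smul' c p := by simp [smul_add]

/-- The conservative part `h = (D₀ ∧ V) / (n + |t|)` of `V ∈ Q t n`. -/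
def consPart (t : Fin 2 → ℕ) (n : ℤ) (V : PolyVF) : Poly :=
  ((n + wt t : ℤ) : ℝ)⁻¹ • wedge (D0 t) V

/-- The dissipative part `μ = div V / (n + |t|)` of `V ∈ Q t n`. -/
def dissPart (t : Fin 2 → ℕ) (n : ℤ) (V : PolyVF) : Poly :=
  ((n + wt t : ℤ) : ℝ)⁻¹ • divergence V

section degrees

variable {t : Fin 2 → ℕ}

lemma mem_P {k : ℤ} {p : Poly} :
    p ∈ P t k ↔ MvPolynomial.IsWeightedHomogeneous (fun i => (t i : ℤ)) p k := Iff.rfl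

lemma mul_mem_P {a b c : ℤ} {p q : Poly} (hp : p ∈ P t a) (hq : q ∈ P t b) (h : a + b = c) :
    p * q ∈ P t c := h ▸ MvPolynomial.IsWeightedHomogeneous.mul hp hq

lemma pderiv_mem_P {a b : ℤ} {p : Poly} (i : Fin 2) (hp : p ∈ P t a) (h : b + t i = a) :
    MvPolynomial.pderiv i p ∈ P t b :=
  MvPolynomial.IsWeightedHomogeneous.pderiv (mem_P.1 hp) h

lemma apply_mem_P {k : ℤ} {V : PolyVF} (hV : V ∈ Q t k) (i : Fin 2) : V i ∈ P t (k + t i) :=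
  Submodule.mem_pi.1 hV i (Set.mem_univ i)

lemma smul_mem_Q {a b c : ℤ} {p : Poly} {V : PolyVF} (hp : p ∈ P t a) (hV : V ∈ Q t b)
    (h : a + b = c) : p • V ∈ Q t c :=
  Submodule.mem_pi.2 fun i _ => mul_mem_P hp (apply_mem_P hV i) (by rw [← h]; ring)

lemma D0_mem_Q : D0 t ∈ Q t 0 :=
  Submodule.mem_pi.2 fun i _ => mul_mem_P (a := 0) (b := t i)
    (MvPolynomial.isWeightedHomogeneous_C _ _) (MvPolynomial.isWeightedHomogeneous_X _ _ _) rfl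

lemma dissPart_mem_P {n : ℤ} {V : PolyVF} (hV : V ∈ Q t n) : dissPart t n V ∈ P t n :=
  (P t n).smul_mem _ ((P t n).add_mem (pderiv_mem_P 0 (apply_mem_P hV 0) rfl)
    (pderiv_mem_P 1 (apply_mem_P hV 1) rfl))

lemma lieD_mem_P {a n c : ℤ} {V : PolyVF} (hV : V ∈ Q t n) (h : a + n = c) {p : Poly}
    (hp : p ∈ P t a) : lieD V p ∈ P t c :=
  (P t c).add_mem
    (mul_mem_P (pderiv_mem_P 0 hp (sub_add_cancel a (t 0 : ℤ))) (apply_mem_P hV 0)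
      (by rw [← h]; ring))
    (mul_mem_P (pderiv_mem_P 1 hp (sub_add_cancel a (t 1 : ℤ))) (apply_mem_P hV 1)
      (by rw [← h]; ring))

end degrees

/-- The operator `ℓ_k : P_{k-n} → P_k`, `p ↦ ∇p · Fₙ`. -/
def ell {t : Fin 2 → ℕ} {n : ℤ} (Fn : Q t n) (k : ℤ) : P t (k - n) →ₗ[ℝ] P t k :=
  (lieD (Fn : PolyVF)).restrict fun _ hp => lieD_mem_P Fn.2 (sub_add_cancel k n) hp

/-- The subspace `h · P_{m-n-|t|}` of `P_m`, where `h` is the conservative part of `Fₙ`. -/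
def hMultiples {t : Fin 2 → ℕ} {n : ℤ} (Fn : Q t n) (m : ℤ) : Submodule ℝ (P t m) :=
  ((P t (m - n - wt t)).map (LinearMap.mulLeft ℝ (consPart t n (Fn : PolyVF)))).comap
    (P t m).subtype

/-- The field `Fₙ - ((n + |t|) / m) μ D₀`, where `μ` is the dissipative part of `Fₙ`. -/
def shifted {t : Fin 2 → ℕ} {n : ℤ} (Fn : Q t n) (m : ℤ) : PolyVF :=
  (Fn : PolyVF) -
    (((n + wt t : ℤ) : ℝ) / (m : ℝ)) • (dissPart t n (Fn : PolyVF) • D0 t)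

lemma shifted_mem_Q {t : Fin 2 → ℕ} {n : ℤ} (Fn : Q t n) (m : ℤ) : shifted Fn m ∈ Q t n :=
  (Q t n).sub_mem Fn.2
    ((Q t n).smul_mem _ (smul_mem_Q (dissPart_mem_P Fn.2) D0_mem_Q (add_zero n)))

/-- The operator `ℓᶜ_m : Δ_{m-n} → Δ_m`,
`g ↦ Proj_{Δ_m} (∇g · (Fₙ - ((n + |t|) / m) μ D₀))`, where `Δ_m` is a complement of
`h · P_{m-n-|t|}` in `P_m` and `Proj_{Δ_m}` is the projection along `h · P_{m-n-|t|}`. -/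
def ellc {t : Fin 2 → ℕ} {n : ℤ} (Fn : Q t n) (Δ : ∀ m : ℤ, Submodule ℝ (P t m))
    (hΔ : ∀ m, IsCompl (Δ m) (hMultiples Fn m)) (m : ℤ) : Δ (m - n) →ₗ[ℝ] Δ m :=
  (Submodule.projectionOnto (Δ m) (hMultiples Fn m) (hΔ m)) ∘ₗ
    ((lieD (shifted Fn m)).restrict
      fun _ hp => lieD_mem_P (shifted_mem_Q Fn m) (sub_add_cancel m n) hp) ∘ₗ
    (Δ (m - n)).subtype

/-- `F = ∑_{j ≥ n} F_j` with `F_j ∈ Q t j`, as formal power series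
(convergence of every coefficient). -/
def IsExpansion {t : Fin 2 → ℕ} (n : ℤ) (F : FormalVF) (Fj : ∀ j : ℤ, Q t j) : Prop :=
  ∀ i : Fin 2, HasSum (fun j : {j : ℤ // n ≤ j} => (((Fj j : PolyVF) i : Poly) : Series)) (F i)

/-- Formal orbital equivalence: there are a formal change of variables `Φ` at the origin,
`Φ(0) = 0`, `det DΦ(0) ≠ 0`, and a formal time rescaling `u`, `u(0) > 0`, such that
`DΦ · F = u · (G ∘ Φ)`. -/
def OrbitallyEquivalent (F G : FormalVF) : Prop :=
  ∃ (Φ : Fin 2 → Series) (u : Series),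
    (∀ i, MvPowerSeries.constantCoeff (Φ i) = 0) ∧
    (Matrix.of fun i j : Fin 2 => MvPowerSeries.coeff (Finsupp.single j 1) (Φ i)).det ≠ 0 ∧
    0 < MvPowerSeries.constantCoeff u ∧
    ∀ i, ∑ j, MvPowerSeries.pderiv ℝ j (Φ i) * F j = u * MvPowerSeries.subst Φ (G i)

end QHNormalForm

end

noncomputable section

namespace QHNormalForm

/-! The argument is degree-by-degree normalisation. If `Φ`, `u`, `G` solve `DΦ · F = u · (G ∘ Φ)`
through degree `n + k - 1`, replace them by `Φ - φ`, `u + v`, `G + W` with `φ ∈ Q t k`, `v ∈ P t k`,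
`W ∈ Q t (n + k)`. Up to higher order the defect then drops by `[φ, Fₙ] + v Fₙ + W`
(`defect_correction_mem`). So it suffices to write every field `V` of degree `n + k` in this form
with `W` in normal form (`exists_homological_solution`).

Put `m = n + k + |t|` and wedge with `D₀`. Then `X_c` contributes `m c`, `v Fₙ` contributes a
multiple of `h`, and `[X_g, Fₙ]` contributes `m ∇g · (Fₙ - ((n + |t|) / m) μ D₀)`, which is `m
ℓᶜ_m(g)` modulo `h`. Since `P_m` is the sum of `Cor(ℓᶜ_m)`, `Range(ℓᶜ_m)` and the multiples of `h`,
suitable `c`, `g`, `v` kill the wedge. What is left is `η D₀`, and the part of `η` in `Range(ℓ)` is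
removed through `∇l · Fₙ D₀ = [l D₀, Fₙ] + n l Fₙ`.

The corrections have growing order, so they converge coefficientwise, and the limit has a defect of
infinite order, hence none. -/

/-- The weighted degree of the monomial with exponent `d`. -/
def deg (t : Fin 2 → ℕ) (d : Fin 2 →₀ ℕ) : ℤ := Finsupp.weight (fun i => (t i : ℤ)) d

/-- The series all of whose monomials have weighted degree at least `N`. -/
def filt (t : Fin 2 → ℕ) (N : ℤ) : Submodule ℝ Series where
  carrier := {f | ∀ d, deg t d < N → MvPowerSeries.coeff d f = 0}
  add_mem' hf hg d hd := by rw [map_add, hf d hd, hg d hd, add_zero]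
  zero_mem' d _ := map_zero _
  smul_mem' c f hf d hd := by rw [map_smul, hf d hd, smul_zero]

/-! ### The filtration of power series by weighted order. -/

section filtration

variable {t : Fin 2 → ℕ}

lemma deg_eq (d : Fin 2 →₀ ℕ) : deg t d = d 0 * t 0 + d 1 * t 1 := by
  simp [deg, Finsupp.weight_eq_sum]

lemma deg_add (d e : Fin 2 →₀ ℕ) : deg t (d + e) = deg t d + deg t e := map_add _ d e

lemma deg_single (i : Fin 2) : deg t (Finsupp.single i 1) = t i := by
  simp [deg, Finsupp.weight_single]

lemma deg_nonneg (d : Fin 2 →₀ ℕ) : 0 ≤ deg t d := by rw [deg_eq]; positivity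

lemma filt_mono {M N : ℤ} (h : N ≤ M) {f : Series} (hf : f ∈ filt t M) : f ∈ filt t N :=
  fun d hd => hf d (hd.trans_le h)

lemma mem_filt_of_nonpos {N : ℤ} (hN : N ≤ 0) (f : Series) : f ∈ filt t N :=
  fun d hd => absurd (hd.trans_le hN) (deg_nonneg d).not_gt

/-- The filtration is separated: each exponent has a finite degree, eventually exceeded by `k + c`.
This turns estimates to every order into an exact equation. -/
lemma eq_zero_of_forall_mem_filt {f : Series} {c : ℤ} (h : ∀ k : ℕ, f ∈ filt t (k + c)) :
    f = 0 := by
  ext d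
  refine h (deg t d + 1 - c).toNat d ?_
  have := Int.self_le_toNat (deg t d + 1 - c)
  linarith

lemma mul_mem_filt {a b c : ℤ} {f g : Series} (hf : f ∈ filt t a) (hg : g ∈ filt t b)
    (h : c ≤ a + b) : f * g ∈ filt t c := by
  classical
  intro d hd
  rw [MvPowerSeries.coeff_mul]
  refine Finset.sum_eq_zero fun p hp => ?_
  rw [Finset.HasAntidiagonal.mem_antidiagonal] at hp
  rw [← hp, deg_add] at hd
  by_cases h1 : deg t p.1 < a
  · rw [hf _ h1, zero_mul]
  · rw [hg _ (by linarith), mul_zero]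

lemma pderiv_mem_filt {a b : ℤ} {f : Series} (i : Fin 2) (hf : f ∈ filt t a)
    (h : b + t i ≤ a) : MvPowerSeries.pderiv ℝ i f ∈ filt t b := by
  intro d hd
  rw [MvPowerSeries.coeff_pderiv, hf _ (by rw [deg_add, deg_single]; linarith), zero_mul]

lemma X_mem_filt (i : Fin 2) : (MvPowerSeries.X i : Series) ∈ filt t (t i) := by
  classical
  intro d hd
  rw [MvPowerSeries.coeff_X, if_neg]
  rintro rfl
  exact hd.ne (deg_single i)

lemma coe_mem_filt {N : ℤ} {p : Poly} (hp : p ∈ P t N) : (p : Series) ∈ filt t N := by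
  intro d hd
  rw [MvPolynomial.coeff_coe]
  by_contra h
  exact hd.ne (hp h)

lemma one_mem_filt : (1 : Series) ∈ filt t 0 := mem_filt_of_nonpos le_rfl _

lemma pow_mem_filt {a : ℤ} {f : Series} (hf : f ∈ filt t a) (m : ℕ) : f ^ m ∈ filt t (m * a) := by
  induction m with
  | zero => simpa using mem_filt_of_nonpos le_rfl _
  | succ m ih =>
    rw [pow_succ]
    exact mul_mem_filt ih hf (by push_cast; linarith)

lemma prod_eq (a : Fin 2 → Series) (d : Fin 2 →₀ ℕ) :
    (d.prod fun s e => a s ^ e) = a 0 ^ d 0 * a 1 ^ d 1 := by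
  rw [Finsupp.prod_fintype _ _ fun _ => pow_zero _, Fin.prod_univ_two]

/-- The monomial with exponent `d` becomes `a₀ ^ d₀ * a₁ ^ d₁`, whose order is at least `deg t d`.
-/
lemma subst_mem_filt {a : Fin 2 → Series} (ha : MvPowerSeries.HasSubst a)
    (h : ∀ i, a i ∈ filt t (t i)) {N : ℤ} {f : Series} (hf : f ∈ filt t N) :
    MvPowerSeries.subst a f ∈ filt t N := by
  intro e he
  rw [MvPowerSeries.coeff_subst ha]
  refine finsum_eq_zero_of_forall_eq_zero fun d => ?_
  by_cases hd : deg t d < N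
  · rw [hf d hd, zero_smul]
  · rw [prod_eq, (mul_mem_filt (pow_mem_filt (h 0) (d 0)) (pow_mem_filt (h 1) (d 1))
      (c := deg t d) (by rw [deg_eq])) e (by linarith), smul_zero]

lemma constantCoeff_eq_zero {f : Series} {N : ℤ} (hN : 0 < N)
    (hf : f ∈ filt t N) : MvPowerSeries.constantCoeff f = 0 := by
  rw [← MvPowerSeries.coeff_zero_eq_constantCoeff_apply]
  exact hf 0 (by simpa [deg_eq] using hN)

lemma hasSubst_of_mem_filt (ht : ∀ i, 0 < t i) {a : Fin 2 → Series}
    (h : ∀ i, a i ∈ filt t (t i)) : MvPowerSeries.HasSubst a :=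
  MvPowerSeries.hasSubst_of_constantCoeff_zero fun i =>
    constantCoeff_eq_zero (by exact_mod_cast ht i) (h i)

/-- Every series is the sum of a polynomial and a series of high order. -/
lemma exists_polynomial_sub_mem_filt (ht : ∀ i, 0 < t i) (f : Series) {N : ℤ}
    (hf : f ∈ filt t N) (M : ℕ) :
    ∃ p : Poly, (p : Series) ∈ filt t N ∧ f - (p : Series) ∈ filt t M := by
  classical
  -- Weights are at least 1, so every exponent of degree below `M` lies in the box `d₀, d₁ ≤ M`.
  let m : Fin 2 →₀ ℕ := Finsupp.equivFunOnFinite.symm fun _ => M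
  refine ⟨MvPowerSeries.trunc' ℝ m f, fun d hd => ?_, fun d hd => ?_⟩
  · rw [MvPolynomial.coeff_coe, MvPowerSeries.coeff_trunc', hf d hd, ite_self]
  · rw [map_sub, MvPolynomial.coeff_coe, MvPowerSeries.coeff_trunc', if_pos, sub_self]
    rw [deg_eq] at hd
    have h0 : (d 0 : ℤ) ≤ d 0 * t 0 :=
      le_mul_of_one_le_right (by positivity) (by exact_mod_cast ht 0)
    have h1 : (d 1 : ℤ) ≤ d 1 * t 1 :=
      le_mul_of_one_le_right (by positivity) (by exact_mod_cast ht 1)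
    intro i
    change d i ≤ M
    fin_cases i
    · change d 0 ≤ M
      have : (0 : ℤ) ≤ d 1 := by positivity
      zify; linarith
    · change d 1 ≤ M
      have : (0 : ℤ) ≤ d 0 := by positivity
      zify; linarith

/-- The quasi-homogeneous part of degree `N` of a series of order at least `N`. -/
lemma exists_leading_part (ht : ∀ i, 0 < t i) {f : Series} {N : ℤ} (hf : f ∈ filt t N) :
    ∃ p ∈ P t N, f - (p : Series) ∈ filt t (N + 1) := by
  obtain ⟨q, -, hq⟩ := exists_polynomial_sub_mem_filt ht f hf (N + 1).toNat
  have hq := filt_mono (Int.self_le_toNat _) hq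
  refine ⟨MvPolynomial.weightedHomogeneousComponent _ N q,
    MvPolynomial.weightedHomogeneousComponent_isWeightedHomogeneous _ _, fun d hd => ?_⟩
  classical
  have hd' := hq d hd
  rw [map_sub, MvPolynomial.coeff_coe] at hd' ⊢
  rw [MvPolynomial.coeff_weightedHomogeneousComponent]
  split_ifs with h
  · exact hd'
  · rw [hf d, sub_zero]
    have : deg t d ≠ N := h
    omega

/-- A sequence of series whose increments have growing order converges. -/
lemma exists_limit {f : ℕ → Series} {c : ℤ} (h : ∀ k : ℕ, f (k + 1) - f k ∈ filt t (k + c)) :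
    ∃ g : Series, ∀ k : ℕ, g - f k ∈ filt t (k + c) := by
  have key : ∀ d (k m : ℕ), deg t d < k + c → k ≤ m →
      MvPowerSeries.coeff d (f m) = MvPowerSeries.coeff d (f k) := by
    intro d k m hd hkm
    induction m, hkm using Nat.le_induction with
    | base => rfl
    | succ m hm ih =>
      rw [← ih, ← sub_eq_zero, ← map_sub]
      have : (k : ℤ) ≤ m := by exact_mod_cast hm
      exact h m d (by linarith)
  -- From this index on `deg t d < k + c`, so the coefficient at `d` no longer changes.
  let g : Series := fun d => MvPowerSeries.coeff d (f (deg t d + 1 - c).toNat)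
  have hg : ∀ d, MvPowerSeries.coeff d g =
      MvPowerSeries.coeff d (f (deg t d + 1 - c).toNat) := fun _ => rfl
  refine ⟨g, fun k d hd => ?_⟩
  rw [map_sub, sub_eq_zero, hg]
  refine (key d _ k ?_ (by omega)).symm
  have := Int.self_le_toNat (deg t d + 1 - c)
  linarith

/-! ### Taylor expansion under substitutions tangent to the identity. -/

/-- The derivative of a series along a formal field. -/
def dirD (φ : Fin 2 → Series) (f : Series) : Series :=
  ∑ j, φ j * MvPowerSeries.pderiv ℝ j f

lemma dirD_mul (φ : Fin 2 → Series) (f g : Series) :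
    dirD φ (f * g) = dirD φ f * g + f * dirD φ g := by
  simp only [dirD, Fin.sum_univ_two, Derivation.leibniz, smul_eq_mul]
  ring

lemma dirD_mem_filt {φ : Fin 2 → Series} {f : Series} {k N M : ℤ}
    (hφ : ∀ i, φ i ∈ filt t (t i + k)) (hf : f ∈ filt t N) (h : M ≤ N + k) :
    dirD φ f ∈ filt t M :=
  (filt t M).sum_mem fun j _ => mul_mem_filt (hφ j)
    (pderiv_mem_filt j hf (sub_add_cancel N (t j : ℤ)).le) (by linarith)

/-- `f` has order at least `N`, and substituting `a` and `b` into it agrees with the expansions of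
order zero and one, up to the expected order. -/
structure TaylorAt (t : Fin 2 → ℕ) (a b : Fin 2 → Series) (k N : ℤ) (f : Series) : Prop where
  mem : f ∈ filt t N
  zeroth : MvPowerSeries.subst a f - f ∈ filt t (N + 1)
  first : MvPowerSeries.subst b f - MvPowerSeries.subst a f - dirD (fun i => b i - a i) f ∈
    filt t (N + k + 1)

section Taylor

variable {a b : Fin 2 → Series} {k N M : ℤ} {f g : Series}

lemma TaylorAt.mono (hf : TaylorAt t a b k M f) (h : N ≤ M) : TaylorAt t a b k N f :=
  ⟨filt_mono h hf.mem, filt_mono (by linarith) hf.zeroth, filt_mono (by linarith) hf.first⟩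

lemma TaylorAt.add (ha : MvPowerSeries.HasSubst a) (hb : MvPowerSeries.HasSubst b)
    (hf : TaylorAt t a b k N f) (hg : TaylorAt t a b k N g) : TaylorAt t a b k N (f + g) := by
  refine ⟨add_mem hf.mem hg.mem, ?_, ?_⟩
  · rw [MvPowerSeries.subst_add ha]
    convert! add_mem hf.zeroth hg.zeroth using 1
    ring
  · rw [MvPowerSeries.subst_add ha, MvPowerSeries.subst_add hb]
    convert! add_mem hf.first hg.first using 1
    simp only [dirD, Fin.sum_univ_two, map_add]
    ring

lemma TaylorAt.zero (ha : MvPowerSeries.HasSubst a) (hb : MvPowerSeries.HasSubst b) :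
    TaylorAt t a b k N 0 := by
  have h : ∀ c : Fin 2 → Series, MvPowerSeries.HasSubst c →
      MvPowerSeries.subst c (0 : Series) = 0 := fun c hc => by
    rw [← MvPowerSeries.coe_substAlgHom hc, map_zero]
  refine ⟨zero_mem _, ?_, ?_⟩ <;> simp [h a ha, h b hb, dirD, zero_mem]

lemma TaylorAt.smul (ha : MvPowerSeries.HasSubst a) (hb : MvPowerSeries.HasSubst b)
    (hf : TaylorAt t a b k N f) (c : ℝ) : TaylorAt t a b k N (c • f) := by
  refine ⟨Submodule.smul_mem _ c hf.mem, ?_, ?_⟩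
  · rw [MvPowerSeries.subst_smul ha]
    convert! Submodule.smul_mem _ c hf.zeroth using 1
    rw [smul_sub]
  · rw [MvPowerSeries.subst_smul ha, MvPowerSeries.subst_smul hb]
    convert! Submodule.smul_mem _ c hf.first using 1
    simp only [dirD, Fin.sum_univ_two, Derivation.map_smul, smul_sub, smul_add, mul_smul_comm]

lemma TaylorAt.one (ha : MvPowerSeries.HasSubst a) (hb : MvPowerSeries.HasSubst b) :
    TaylorAt t a b k 0 1 := by
  have h : ∀ c : Fin 2 → Series, MvPowerSeries.HasSubst c →
      MvPowerSeries.subst c (1 : Series) = 1 := fun c hc => by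
    rw [← MvPowerSeries.coe_substAlgHom hc, map_one]
  refine ⟨one_mem_filt, ?_, ?_⟩ <;> simp [h a ha, h b hb, dirD, zero_mem]

lemma TaylorAt.X (ha : MvPowerSeries.HasSubst a) (hb : MvPowerSeries.HasSubst b)
    (ha' : ∀ i, a i - MvPowerSeries.X i ∈ filt t (t i + 1)) (i : Fin 2) :
    TaylorAt t a b k (t i) (MvPowerSeries.X i) := by
  refine ⟨X_mem_filt i, ?_, ?_⟩
  · rw [MvPowerSeries.subst_X ha]
    exact ha' i
  · rw [MvPowerSeries.subst_X ha, MvPowerSeries.subst_X hb]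
    simp [dirD, MvPowerSeries.pderiv_X, Pi.single_apply, zero_mem]

/-- With `D = dirD (b - a)`, the first-order remainder of `f g` is `(f(b) - f(a) - Df) g(b) + Df
(g(b) - g) + f(a) (g(b) - g(a) - Dg) + (f(a) - f) Dg`. As `D` acts on `f` and `g` themselves, not on
their values at `a`, the zeroth-order estimates are needed too. -/
lemma TaylorAt.mul (ha : MvPowerSeries.HasSubst a) (hb : MvPowerSeries.HasSubst b)
    (hab : ∀ i, b i - a i ∈ filt t (t i + k)) (hk : 1 ≤ k)
    (hf : TaylorAt t a b k N f) (hg : TaylorAt t a b k M g) :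
    TaylorAt t a b k (N + M) (f * g) := by
  have hDf := dirD_mem_filt hab hf.mem le_rfl
  have hDg := dirD_mem_filt hab hg.mem le_rfl
  have hag : MvPowerSeries.subst a g ∈ filt t M := by
    simpa using add_mem (filt_mono (by linarith) hg.zeroth) hg.mem
  have hbg : MvPowerSeries.subst b g - g ∈ filt t (M + 1) := by
    convert! add_mem (add_mem (filt_mono (by linarith) hg.first) (filt_mono (by linarith) hDg))
      hg.zeroth using 1
    ring
  have hbg' : MvPowerSeries.subst b g ∈ filt t M := by
    simpa using add_mem (filt_mono (by linarith) hbg) hg.mem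
  have haf : MvPowerSeries.subst a f ∈ filt t N := by
    simpa using add_mem (filt_mono (by linarith) hf.zeroth) hf.mem
  refine ⟨mul_mem_filt hf.mem hg.mem le_rfl, ?_, ?_⟩
  · rw [MvPowerSeries.subst_mul ha]
    convert! add_mem (mul_mem_filt hf.zeroth hag (c := N + M + 1) (by linarith))
      (mul_mem_filt hf.mem hg.zeroth (c := N + M + 1) (by linarith)) using 1
    ring
  · rw [MvPowerSeries.subst_mul ha, MvPowerSeries.subst_mul hb, dirD_mul]
    convert! add_mem (add_mem
      (mul_mem_filt hf.first hbg' (c := N + M + k + 1) (by linarith))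
      (mul_mem_filt hDf hbg (c := N + M + k + 1) (by linarith))) (add_mem
      (mul_mem_filt haf hg.first (c := N + M + k + 1) (by linarith))
      (mul_mem_filt hf.zeroth hDg (c := N + M + k + 1) (by linarith))) using 1
    ring

lemma TaylorAt.pow (ha : MvPowerSeries.HasSubst a) (hb : MvPowerSeries.HasSubst b)
    (hab : ∀ i, b i - a i ∈ filt t (t i + k)) (hk : 1 ≤ k)
    (hf : TaylorAt t a b k N f) (m : ℕ) : TaylorAt t a b k (m * N) (f ^ m) := by
  induction m with
  | zero => simpa using TaylorAt.one ha hb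
  | succ m ih =>
    rw [pow_succ]
    exact (ih.mul ha hb hab hk hf).mono (by push_cast; linarith)

lemma TaylorAt.of_coe (ha : MvPowerSeries.HasSubst a) (hb : MvPowerSeries.HasSubst b)
    (ha' : ∀ i, a i - MvPowerSeries.X i ∈ filt t (t i + 1))
    (hab : ∀ i, b i - a i ∈ filt t (t i + k)) (hk : 1 ≤ k) {p : Poly}
    (hp : (p : Series) ∈ filt t N) : TaylorAt t a b k N (p : Series) := by
  have key : ∀ s : Finset (Fin 2 →₀ ℕ), TaylorAt t a b k N
      ((∑ d ∈ s, MvPolynomial.monomial d (p.coeff d) : Poly) : Series) := by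
    intro s
    induction s using Finset.cons_induction with
    | empty => simpa using TaylorAt.zero ha hb
    | cons d s hd ih =>
      rw [Finset.sum_cons, MvPolynomial.coe_add]
      refine TaylorAt.add ha hb ?_ ih
      by_cases h : deg t d < N
      · have := hp d h
        rw [MvPolynomial.coeff_coe] at this
        simpa [this] using TaylorAt.zero ha hb
      · have h1 : ((MvPolynomial.monomial d (p.coeff d) : Poly) : Series) =
            p.coeff d • ((MvPowerSeries.X 0 : Series) ^ d 0 * MvPowerSeries.X 1 ^ d 1) := by
          rw [MvPolynomial.monomial_eq, Finsupp.prod_fintype _ _ fun _ => pow_zero _,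
            Fin.prod_univ_two, MvPolynomial.C_mul', MvPolynomial.coe_smul, MvPolynomial.coe_mul,
            MvPolynomial.coe_pow, MvPolynomial.coe_pow, MvPolynomial.coe_X, MvPolynomial.coe_X]
        rw [h1]
        refine TaylorAt.smul ha hb (TaylorAt.mono ?_ (not_lt.1 h)) _
        rw [deg_eq]
        exact (((TaylorAt.X ha hb ha' 0).pow ha hb hab hk _).mul ha hb hab hk
          ((TaylorAt.X ha hb ha' 1).pow ha hb hab hk _))
  have := key p.support
  rwa [← MvPolynomial.as_sum] at this

lemma mem_filt_of_sub_X (ha' : ∀ i, a i - MvPowerSeries.X i ∈ filt t (t i + 1)) (i : Fin 2) :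
    a i ∈ filt t (t i) := by
  simpa using add_mem (filt_mono (by linarith) (ha' i)) (X_mem_filt i)

/-- First order Taylor expansion of `f` under a substitution tangent to the identity. -/
lemma taylorAt (ht : ∀ i, 0 < t i)
    (ha : ∀ i, a i - MvPowerSeries.X i ∈ filt t (t i + 1))
    (hab : ∀ i, b i - a i ∈ filt t (t i + k)) (hk : 1 ≤ k) (hf : f ∈ filt t N) :
    TaylorAt t a b k N f := by
  have hb : ∀ i, b i - MvPowerSeries.X i ∈ filt t (t i + 1) := fun i => by
    simpa using add_mem (filt_mono (by linarith) (hab i)) (ha i)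
  have ha1 := mem_filt_of_sub_X ha
  have hb1 := mem_filt_of_sub_X hb
  have has := hasSubst_of_mem_filt ht ha1
  have hbs := hasSubst_of_mem_filt ht hb1
  -- Cut at order `N + k + 1`: every term of the estimates for the tail is then small enough by
  -- itself, and only a polynomial remains.
  obtain ⟨p, hp, hpf⟩ := exists_polynomial_sub_mem_filt ht f hf (N + k + 1).toNat
  have hpf := filt_mono (Int.self_le_toNat _) hpf
  have h1 : TaylorAt t a b k N (f - p) := by
    have h2 := subst_mem_filt has ha1 hpf
    refine ⟨filt_mono (by linarith) hpf, filt_mono (by linarith) (sub_mem h2 hpf),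
      sub_mem (sub_mem (subst_mem_filt hbs hb1 hpf) h2)
        (dirD_mem_filt hab hpf (by linarith))⟩
  simpa using h1.add has hbs (TaylorAt.of_coe has hbs ha hab hk hp)

/-- Zeroth order Taylor expansion. -/
lemma subst_sub_subst_mem_filt (ht : ∀ i, 0 < t i)
    (ha : ∀ i, a i - MvPowerSeries.X i ∈ filt t (t i + 1))
    (hab : ∀ i, b i - a i ∈ filt t (t i + k)) (hk : 1 ≤ k) (hf : f ∈ filt t N) :
    MvPowerSeries.subst b f - MvPowerSeries.subst a f ∈ filt t (N + k) := by
  simpa using add_mem (filt_mono (by linarith) (taylorAt ht ha hab hk hf).first)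
    (dirD_mem_filt hab hf le_rfl)

end Taylor

end filtration

/-! ### Euler's identity and the homological equation. -/

/-- The bracket `DU · V - DV · U`. -/
def bracket (U V : PolyVF) : PolyVF := fun i => lieD V (U i) - lieD U (V i)

section homological

open MvPolynomial (C X pderiv)

variable {t : Fin 2 → ℕ}

lemma lieD_apply (V : PolyVF) (p : Poly) :
    lieD V p = pderiv 0 p * V 0 + pderiv 1 p * V 1 := rfl

lemma euler {k : ℤ} {p : Poly} (hp : p ∈ P t k) :
    pderiv 0 p * (C (t 0 : ℝ) * X 0) + pderiv 1 p * (C (t 1 : ℝ) * X 1) = C (k : ℝ) * p := by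
  have key : ∀ d ∈ p.support, lieD (D0 t) (MvPolynomial.monomial d (p.coeff d)) =
      (k : ℝ) • MvPolynomial.monomial d (p.coeff d) := by
    intro d hd
    have hw : deg t d = k := hp (MvPolynomial.mem_support_iff.1 hd)
    rw [deg_eq] at hw
    have h : ∀ i, pderiv i (MvPolynomial.monomial d (p.coeff d)) * (C (t i : ℝ) * X i) =
        C (t i : ℝ) * (d i • MvPolynomial.monomial d (p.coeff d)) := fun i => by
      rw [← MvPolynomial.X_mul_pderiv_monomial]; ring
    simp only [lieD_apply, D0]
    rw [h 0, h 1, ← hw, MvPolynomial.smul_eq_C_mul]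
    push_cast
    simp only [map_add, map_mul, nsmul_eq_mul, map_natCast]
    ring
  have h := Finset.sum_congr rfl key
  rw [← map_sum, ← Finset.smul_sum, ← MvPolynomial.as_sum, MvPolynomial.smul_eq_C_mul] at h
  exact h

lemma smul_eq_ham_add {j : ℤ} {V : PolyVF} (hV : V ∈ Q t j) :
    ((j + wt t : ℤ) : ℝ) • V = ham (wedge (D0 t) V) + divergence V • D0 t := by
  have e0 := euler (apply_mem_P hV 0)
  have e1 := euler (apply_mem_P hV 1)
  funext i
  fin_cases i <;>
  · simp [ham, wedge, D0, divergence, wt, MvPolynomial.smul_eq_C_mul, MvPolynomial.pderiv_X,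
      Derivation.leibniz] at *
    first | linear_combination -e0 | linear_combination -e1

lemma pderiv_comm (i j : Fin 2) (p : Poly) : pderiv i (pderiv j p) = pderiv j (pderiv i p) := by
  rcases eq_or_ne i j with rfl | hij
  · rfl
  ext d
  simp only [MvPolynomial.coeff_pderiv, Finsupp.add_apply, Finsupp.single_eq_of_ne hij,
    Finsupp.single_eq_of_ne hij.symm, add_zero]
  rw [add_right_comm]
  ring

/-- Euler's identity for `∂ᵢg` absorbs the second derivatives of `g`, for `Fᵢ` the derivatives of
`F`; the remaining `div F * (∇g · D₀)` is `s * div F * g`. -/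
lemma wedge_bracket_ham {n s : ℤ} {F : PolyVF} (hF : F ∈ Q t n) {g : Poly} (hg : g ∈ P t s) :
    wedge (D0 t) (bracket (ham g) F) =
      C ((n + s : ℤ) : ℝ) * lieD F g - C (s : ℝ) * (divergence F * g) := by
  have e1 := euler (pderiv_mem_P 0 hg (sub_add_cancel s (t 0 : ℤ)))
  have e2 := euler (pderiv_mem_P 1 hg (sub_add_cancel s (t 1 : ℤ)))
  have e3 := euler (apply_mem_P hF 0)
  have e4 := euler (apply_mem_P hF 1)
  have e5 := euler hg
  have hc : pderiv 1 (pderiv 0 g) = pderiv 0 (pderiv 1 g) := pderiv_comm 1 0 g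
  simp only [wedge, D0, bracket, ham, divergence, lieD_apply, Matrix.cons_val_zero,
    Matrix.cons_val_one, map_neg]
  push_cast at *
  simp only [map_add, map_sub] at *
  rw [hc] at *
  linear_combination F 0 * e1 + F 1 * e2 + pderiv 1 g * e4 + pderiv 0 g * e3 -
    (pderiv 0 (F 0) + pderiv 1 (F 1)) * e5

lemma wedge_ham {s : ℤ} {g : Poly} (hg : g ∈ P t s) :
    wedge (D0 t) (ham g) = C (s : ℝ) * g := by
  rw [← euler hg]
  simp only [wedge, D0, ham, Matrix.cons_val_zero, Matrix.cons_val_one]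
  ring

lemma bracket_smul_D0 {n : ℤ} {F : PolyVF} (hF : F ∈ Q t n) (p : Poly) :
    bracket (p • D0 t) F = lieD F p • D0 t - ((n : ℝ) • p) • F := by
  funext i
  have e := euler (apply_mem_P hF i)
  fin_cases i <;>
  · simp [bracket, lieD_apply, D0, MvPolynomial.smul_eq_C_mul, Derivation.leibniz] at *
    linear_combination -p * e

lemma bracket_add_left (U V W : PolyVF) : bracket (U + V) W = bracket U W + bracket V W := by
  funext i
  simp only [bracket, lieD_apply, Pi.add_apply, map_add]
  ring

lemma bracket_zero_left (W : PolyVF) : bracket 0 W = 0 := by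
  funext i
  simp [bracket, lieD_apply]

lemma ham_mem_Q {g : Poly} {s k : ℤ} (hg : g ∈ P t s) (h : k + wt t = s) : ham g ∈ Q t k := by
  refine Submodule.mem_pi.2 fun i _ => ?_
  fin_cases i
  · exact neg_mem (pderiv_mem_P 1 hg (by rw [← h, wt]; simp; ring))
  · exact pderiv_mem_P 0 hg (by rw [← h, wt]; simp; ring)

lemma wedge_mem_P {j m : ℤ} {V : PolyVF} (hV : V ∈ Q t j) (h : j + wt t = m) :
    wedge (D0 t) V ∈ P t m :=
  sub_mem (mul_mem_P (apply_mem_P D0_mem_Q 0) (apply_mem_P hV 1) (by rw [← h, wt]; ring))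
    (mul_mem_P (apply_mem_P D0_mem_Q 1) (apply_mem_P hV 0) (by rw [← h, wt]; ring))

lemma divergence_mem_P {j : ℤ} {V : PolyVF} (hV : V ∈ Q t j) : divergence V ∈ P t j :=
  (P t j).add_mem (pderiv_mem_P 0 (apply_mem_P hV 0) rfl) (pderiv_mem_P 1 (apply_mem_P hV 1) rfl)

lemma eq_zero_of_mem_P {k : ℤ} (hk : k < 0) {p : Poly} (hp : p ∈ P t k) : p = 0 := by
  ext d
  by_contra h
  have h1 : deg t d = k := hp h
  have := deg_nonneg (t := t) d
  omega

lemma eq_zero_of_mem_Q (ht : ∀ i, 0 < t i) {j : ℤ} (hj : j + wt t ≤ 0) {V : PolyVF}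
    (hV : V ∈ Q t j) : V = 0 := by
  have h0 := ht 0
  have h1 := ht 1
  rw [wt] at hj
  funext i
  fin_cases i
  · exact eq_zero_of_mem_P (k := j + t 0) (by omega) (apply_mem_P hV 0)
  · exact eq_zero_of_mem_P (k := j + t 1) (by omega) (apply_mem_P hV 1)

/-- Without its conservative part, a field in the splitting `smul_eq_ham_add` reduces to the
dissipative part. -/
lemma exists_eq_smul_D0 {j : ℤ} (hj : j + wt t ≠ 0) {V : PolyVF} (hV : V ∈ Q t j)
    (h : wedge (D0 t) V = 0) : ∃ η ∈ P t j, V = η • D0 t := by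
  have hj' : ((j + wt t : ℤ) : ℝ) ≠ 0 := by exact_mod_cast hj
  refine ⟨((j + wt t : ℤ) : ℝ)⁻¹ • divergence V, (P t j).smul_mem _ (divergence_mem_P hV), ?_⟩
  have h1 := smul_eq_ham_add hV
  have h2 : ham 0 = 0 := by funext i; fin_cases i <;> simp [ham]
  rw [h, h2, zero_add] at h1
  rw [smul_assoc, ← h1, smul_smul, inv_mul_cancel₀ hj', one_smul]

lemma smul_dissPart (ht : ∀ i, 0 < t i) {n : ℤ} {V : PolyVF} (hV : V ∈ Q t n) :
    ((n + wt t : ℤ) : ℝ) • dissPart t n V = divergence V := by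
  by_cases h : n + wt t = 0
  · rw [eq_zero_of_mem_Q ht h.le hV]
    simp [dissPart, divergence]
  · have h' : ((n + wt t : ℤ) : ℝ) ≠ 0 := by exact_mod_cast h
    rw [dissPart, smul_smul, mul_inv_cancel₀ h', one_smul]

/-- The shift by `μ D₀` is what produces the divergence term of `wedge_bracket_ham`: here `∇g · D₀ =
(m - n) g` and `div Fₙ = (n + |t|) μ`. -/
lemma smul_lieD_shifted (ht : ∀ i, 0 < t i) {n m : ℤ} (hm : m ≠ 0) (Fn : Q t n) {g : Poly}
    (hg : g ∈ P t (m - n)) :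
    C (m : ℝ) * lieD (shifted Fn m) g = wedge (D0 t) (bracket (ham g) (Fn : PolyVF)) := by
  have hm' : (m : ℝ) ≠ 0 := by exact_mod_cast hm
  have hC : (C (m : ℝ) : Poly) * C (m : ℝ)⁻¹ = 1 := by
    rw [← map_mul, mul_inv_cancel₀ hm', map_one]
  have e := euler hg
  have hd := smul_dissPart ht Fn.2
  rw [MvPolynomial.smul_eq_C_mul] at hd
  rw [wedge_bracket_ham Fn.2 hg, ← hd, add_sub_cancel]
  simp only [lieD_apply, shifted, D0, Pi.sub_apply, Pi.smul_apply, smul_eq_mul,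
    MvPolynomial.smul_eq_C_mul, div_eq_mul_inv, map_mul]
  linear_combination (-C ((n + wt t : ℤ) : ℝ) * dissPart t n (Fn : PolyVF)) * e -
    (C ((n + wt t : ℤ) : ℝ) * dissPart t n (Fn : PolyVF)) *
    (pderiv 0 g * (C (t 0 : ℝ) * X 0) + pderiv 1 g * (C (t 1 : ℝ) * X 1)) * hC

/-- The homological equation: a field of degree `n + k` is, up to a field in normal form, the
bracket of a field of degree `k` with `Fₙ` plus a multiple of `Fₙ`. This needs no condition on
the kernels of the operators `ℓᶜ`: only their ranges and the complements of these matter. -/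
theorem exists_homological_solution (ht : ∀ i, 0 < t i) {n : ℤ} (Fn : Q t n)
    (Δ : ∀ m : ℤ, Submodule ℝ (P t m)) (hΔ : ∀ m, IsCompl (Δ m) (hMultiples Fn m))
    (Cor : ∀ k : ℤ, Submodule ℝ (P t k))
    (hCor : ∀ k, IsCompl (Cor k) (LinearMap.range (ell Fn k)))
    (Corc : ∀ m : ℤ, Submodule ℝ (Δ m))
    (hCorc : ∀ m, IsCompl (Corc m) (LinearMap.range (ellc Fn Δ hΔ m)))
    {j k : ℤ} (hj : n + k = j) {V : PolyVF} (hV : V ∈ Q t j) :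
    ∃ φ ∈ Q t k, ∃ v ∈ P t k, ∃ c ∈ Corc (j + wt t), ∃ η ∈ Cor j,
      V = bracket φ Fn + v • (Fn : PolyVF) + (ham (c : P t (j + wt t)) + (η : Poly) • D0 t) := by
  -- If `j + |t| ≤ 0` both components of `V` have negative degree, so `V = 0`; otherwise one may
  -- divide by `m = j + |t|`.
  rcases le_or_gt (j + wt t) 0 with hneg | hpos
  · refine ⟨0, zero_mem _, 0, zero_mem _, 0, zero_mem _, 0, zero_mem _, ?_⟩
    have h2 : ham 0 = 0 := by funext i; fin_cases i <;> simp [ham]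
    simp [eq_zero_of_mem_Q ht hneg hV, bracket_zero_left, h2]
  obtain ⟨m, hm⟩ : ∃ m, m = j + wt t := ⟨_, rfl⟩
  rw [← hm] at hpos ⊢
  have hm' : (m : ℝ) ≠ 0 := by exact_mod_cast hpos.ne'
  have hC : (C (m : ℝ) : Poly) * C (m : ℝ)⁻¹ = 1 := by
    rw [← map_mul, mul_inv_cancel₀ hm', map_one]
  let w : P t m := ⟨(m : ℝ)⁻¹ • wedge (D0 t) V, (P t m).smul_mem _ (wedge_mem_P hV hm.symm)⟩
  obtain ⟨δ, r, hδ, hr, hw⟩ := Submodule.codisjoint_iff_exists_add_eq.1 (hΔ m).codisjoint w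
  obtain ⟨c, s, hc, ⟨g, rfl⟩, hδ'⟩ :=
    Submodule.codisjoint_iff_exists_add_eq.1 (hCorc m).codisjoint ⟨δ, hδ⟩
  let L : P t m := ⟨lieD (shifted Fn m) (g : P t (m - n)),
    lieD_mem_P (shifted_mem_Q Fn m) (sub_add_cancel m n) (g : P t (m - n)).2⟩
  have hL : L - (ellc Fn Δ hΔ m g : P t m) ∈ hMultiples Fn m := by
    rw [← Submodule.projectionOnto_apply_eq_zero_iff (hΔ m), map_sub,
      Submodule.projectionOnto_apply_left]
    exact sub_self _
  obtain ⟨p, hp, hpr⟩ := sub_mem hr hL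
  have hp : p ∈ P t k := by
    have : m - n - wt t = k := by omega
    exact this ▸ hp
  have hpr : consPart t n (Fn : PolyVF) * p =
      (r : Poly) - (lieD (shifted Fn m) (g : P t (m - n)) - (ellc Fn Δ hΔ m g : P t m)) := hpr
  have hw : ((c : P t m) : Poly) + ((ellc Fn Δ hΔ m g : P t m) : Poly) + (r : Poly) =
      C (m : ℝ)⁻¹ * wedge (D0 t) V := by
    have h1 := congrArg Subtype.val hw
    have h2 := congrArg (fun x : Δ m => ((x : P t m) : Poly)) hδ'
    rw [← MvPolynomial.smul_eq_C_mul]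
    refine Eq.trans ?_ h1
    exact congrArg (· + (r : Poly)) h2
  have hL' := smul_lieD_shifted ht hpos.ne' Fn (g : P t (m - n)).2
  rw [consPart, MvPolynomial.smul_eq_C_mul] at hpr
  -- Chosen so that `q * (D₀ ∧ Fₙ) = m h p`. If `n + |t| = 0` the inverse is `0` here and in `h`
  -- alike, so no separate case arises.
  let q : Poly := C (m : ℝ) * C ((n + wt t : ℤ) : ℝ)⁻¹ * p
  have hq : q ∈ P t k := by
    have h := (P t k).smul_mem ((m : ℝ) * ((n + wt t : ℤ) : ℝ)⁻¹) hp
    rwa [MvPolynomial.smul_eq_C_mul, map_mul] at h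
  have hg : ham (g : P t (m - n)) ∈ Q t k := ham_mem_Q (g : P t (m - n)).2 (by omega)
  have hbr : bracket (ham (g : P t (m - n))) Fn ∈ Q t j := by
    refine Submodule.mem_pi.2 fun i _ => ?_
    exact sub_mem (lieD_mem_P Fn.2 (by omega) (apply_mem_P hg i))
      (lieD_mem_P hg (by omega) (apply_mem_P Fn.2 i))
  let W : PolyVF := V - bracket (ham (g : P t (m - n))) Fn - q • (Fn : PolyVF) - ham (c : P t m)
  have hW : W ∈ Q t j := sub_mem (sub_mem (sub_mem hV hbr)
    (smul_mem_Q hq Fn.2 (by omega))) (ham_mem_Q (c : P t m).2 hm.symm)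
  have hW0 : wedge (D0 t) W = 0 := by
    have e : wedge (D0 t) W = wedge (D0 t) V - wedge (D0 t) (bracket (ham (g : P t (m - n))) Fn) -
        q * wedge (D0 t) Fn - wedge (D0 t) (ham (c : P t m)) := by
      simp only [wedge, W, Pi.sub_apply, Pi.smul_apply, smul_eq_mul]
      ring
    rw [e, ← hL', wedge_ham (c : P t m).2]
    linear_combination (-C (m : ℝ)) * hw - C (m : ℝ) * hpr - wedge (D0 t) V * hC
  obtain ⟨η, hη, hWη⟩ := exists_eq_smul_D0 (hm ▸ hpos.ne') hW hW0
  obtain ⟨η', s', hη', ⟨l, rfl⟩, hηl⟩ :=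
    Submodule.codisjoint_iff_exists_add_eq.1 (hCor j).codisjoint ⟨η, hη⟩
  have hηl : (η' : Poly) + lieD (Fn : PolyVF) l = η := congrArg Subtype.val hηl
  have hl : (l : Poly) ∈ P t k := by
    have : j - n = k := by omega
    exact this ▸ l.2
  -- The summand `n l` of `v` cancels the `-n l Fₙ` in `[l D₀, Fₙ]`.
  refine ⟨ham (g : P t (m - n)) + (l : Poly) • D0 t,
    add_mem hg (smul_mem_Q hl D0_mem_Q (add_zero k)),
    q + (n : ℝ) • (l : Poly), add_mem hq ((P t k).smul_mem _ hl), c, hc, η', hη', ?_⟩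
  rw [bracket_add_left, bracket_smul_D0 Fn.2, add_smul]
  rw [← hηl, add_smul] at hWη
  rw [← sub_eq_zero] at hWη ⊢
  rw [← hWη]
  simp only [W]
  abel

end homological

/-! ### Successive approximation and passage to the limit. -/

/-- The defect `DΦ · F - u · (G ∘ Φ)` of the equation of orbital equivalence. -/
def defect (F : FormalVF) (Φ : Fin 2 → Series) (u : Series) (G : FormalVF) : FormalVF :=
  fun i => ∑ j, MvPowerSeries.pderiv ℝ j (Φ i) * F j - u * MvPowerSeries.subst Φ (G i)

/-- A change of variables, a time rescaling and a target field with leading part `Fn` that solve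
the equation of orbital equivalence up to degree `n + k`. -/
structure ApproxSolution (t : Fin 2 → ℕ) (n : ℤ) (F : FormalVF) (Fn : PolyVF) (k : ℕ) where
  Φ : Fin 2 → Series
  u : Series
  G : FormalVF
  Φ_sub_mem : ∀ i, Φ i - MvPowerSeries.X i ∈ filt t (t i + 1)
  u_sub_mem : u - 1 ∈ filt t 1
  G_sub_mem : ∀ i, G i - (Fn i : Series) ∈ filt t (n + t i + 1)
  defect_mem : ∀ i, defect F Φ u G i ∈ filt t (k + (n + t i + 1))

section solution

variable {t : Fin 2 → ℕ} {n : ℤ} {F : FormalVF} {Fn : PolyVF}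

lemma coe_bracket (U V : PolyVF) (i : Fin 2) :
    (bracket U V i : Series) = ∑ j, MvPowerSeries.pderiv ℝ j (U i : Series) * (V j : Series) -
      dirD (fun j => (U j : Series)) (V i : Series) := by
  have h : ∀ p q : Poly, ((p - q : Poly) : Series) = (p : Series) - q := fun p q =>
    map_sub MvPolynomial.coeToMvPowerSeries.ringHom p q
  simp only [bracket, lieD_apply, dirD, Fin.sum_univ_two, MvPowerSeries.pderiv_coe, h,
    MvPolynomial.coe_add, MvPolynomial.coe_mul]
  ring

lemma mem_filt_of_sub_coe {N : ℤ} {f : Series} {p : Poly} (hp : p ∈ P t N)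
    (h : f - (p : Series) ∈ filt t (N + 1)) : f ∈ filt t N := by
  simpa using add_mem (filt_mono (by linarith) h) (coe_mem_filt hp)

/-- The effect on the defect of a correction of degree `k + 1`. -/
lemma defect_correction_mem (ht : ∀ i, 0 < t i) (hFn : Fn ∈ Q t n)
    (hF : ∀ i, F i - (Fn i : Series) ∈ filt t (n + t i + 1)) {k : ℕ}
    (s : ApproxSolution t n F Fn k) {φ W : PolyVF} {v : Poly} (hφ : φ ∈ Q t (k + 1))
    (hv : v ∈ P t (k + 1)) (hW : W ∈ Q t (n + k + 1)) (i : Fin 2) :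
    defect F (fun i => s.Φ i - (φ i : Series)) (s.u + v) (fun i => s.G i + (W i : Series)) i -
      defect F s.Φ s.u s.G i + ((bracket φ Fn + v • Fn + W) i : Poly) ∈
      filt t ((k + 1 : ℕ) + (n + t i + 1)) := by
  let b : Fin 2 → Series := fun i => s.Φ i - (φ i : Series)
  have hφ' : ∀ i, (φ i : Series) ∈ filt t (t i + (k + 1)) := fun i =>
    filt_mono (by linarith) (coe_mem_filt (apply_mem_P hφ i))
  have hv' := coe_mem_filt hv
  have hba : ∀ i, b i - s.Φ i ∈ filt t (t i + (k + 1)) := fun i => by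
    simpa [b] using hφ' i
  have hk : (1 : ℤ) ≤ k + 1 := by linarith [Int.natCast_nonneg k]
  have hbX : ∀ i, b i - MvPowerSeries.X i ∈ filt t (t i + 1) := fun i => by
    simpa using add_mem (filt_mono (by linarith) (hba i)) (s.Φ_sub_mem i)
  have hsb := hasSubst_of_mem_filt ht (mem_filt_of_sub_X hbX)
  have hG := mem_filt_of_sub_coe (apply_mem_P hFn i) (s.G_sub_mem i)
  have hWi := coe_mem_filt (apply_mem_P hW i)
  have hT := (taylorAt ht s.Φ_sub_mem hba hk hG).first
  have hBA := subst_sub_subst_mem_filt ht s.Φ_sub_mem hba hk hG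
  have hA := (taylorAt ht s.Φ_sub_mem hba hk hG).zeroth
  have hCW := (taylorAt ht hbX (b := b) (k := 1) (by simp [zero_mem]) le_rfl hWi).zeroth
  have hC := subst_mem_filt hsb (mem_filt_of_sub_X hbX) hWi
  have hu := filt_mono zero_le_one (s.u_sub_mem)
  have hu0 : s.u ∈ filt t 0 := by simpa using add_mem hu one_mem_filt
  have hB : MvPowerSeries.subst b (s.G i) - (Fn i : Series) ∈ filt t (n + t i + 1) := by
    convert! add_mem (add_mem (filt_mono (by linarith) hBA) hA) (s.G_sub_mem i) using 1
    ring
  have key : ∀ M : ℤ, M = (k + 1 : ℕ) + (n + t i + 1) →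
      defect F b (s.u + v) (fun i => s.G i + (W i : Series)) i -
      defect F s.Φ s.u s.G i + ((bracket φ Fn + v • Fn + W) i : Poly) ∈ filt t M := by
    intro M hM
    push_cast at hM
    -- `h1` to `h7` are the errors of replacing `F` and `G` by `Fₙ`, `u` and `u + v` by `1`, `W ∘ Φ`
    -- by `W`, and of linearising `G ∘ Φ` in `φ`.
    have h1 : ∑ j, MvPowerSeries.pderiv ℝ j (φ i : Series) * (F j - (Fn j : Series)) ∈ filt t M :=
      (filt t M).sum_mem fun j _ => mul_mem_filt
        (pderiv_mem_filt j (hφ' i) (sub_add_cancel _ (t j : ℤ)).le) (hF j) (by linarith)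
    have h2 := mul_mem_filt hu0 hT (c := M) (by linarith)
    have h3 := mul_mem_filt s.u_sub_mem (dirD_mem_filt hφ' hG le_rfl) (c := M) (by linarith)
    have h4 := dirD_mem_filt hφ' (s.G_sub_mem i) (M := M) (by linarith)
    have h5 := mul_mem_filt hv' hB (c := M) (by linarith)
    have h6 := filt_mono (N := M) (by linarith) hCW
    have h7 := mul_mem_filt (add_mem s.u_sub_mem (filt_mono hk hv')) hC (c := M) (by linarith)
    convert! sub_mem (sub_mem (sub_mem (add_mem (sub_mem h3 h1) h4) h2) h5) (add_mem h6 h7) using 1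
    have hb : (fun i => b i - s.Φ i) = fun i => -(φ i : Series) := by funext i; simp [b]
    rw [Pi.add_apply, Pi.add_apply, MvPolynomial.coe_add, MvPolynomial.coe_add, coe_bracket, hb,
      Pi.smul_apply, smul_eq_mul, MvPolynomial.coe_mul]
    simp only [defect, dirD, MvPowerSeries.subst_add hsb, Fin.sum_univ_two, b, map_sub]
    ring
  exact key _ rfl

/-- One step of the recursion. -/
lemma exists_next (ht : ∀ i, 0 < t i) (hFn : Fn ∈ Q t n)
    (hF : ∀ i, F i - (Fn i : Series) ∈ filt t (n + t i + 1)) {NF : ℤ → PolyVF → Prop}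
    (hsol : ∀ j k : ℤ, n + k = j → ∀ V ∈ Q t j, ∃ φ ∈ Q t k, ∃ v ∈ P t k, ∃ W ∈ Q t j,
      NF j W ∧ V = bracket φ Fn + v • Fn + W) {k : ℕ} (s : ApproxSolution t n F Fn k) :
    ∃ (s' : ApproxSolution t n F Fn (k + 1)), ∃ W ∈ Q t (n + k + 1), NF (n + k + 1) W ∧
      (∀ i, s'.Φ i - s.Φ i ∈ filt t (k + (t i + 1))) ∧ s'.u - s.u ∈ filt t (k + 1) ∧
      ∀ i, s'.G i = s.G i + (W i : Series) := by
  choose R hR hR' using fun i => exists_leading_part ht (s.defect_mem i)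
  have hRQ : R ∈ Q t (n + k + 1) := Submodule.mem_pi.2 fun i _ => by
    convert! hR i using 2
    ring
  -- `R`, the leading part of the defect, is exactly what the correction by `φ`, `v`, `W` cancels.
  obtain ⟨φ, hφ, v, hv, W, hW, hNF, rfl⟩ := hsol (n + k + 1) (k + 1) (by ring) R hRQ
  have hk : (1 : ℤ) ≤ k + 1 := by linarith [Int.natCast_nonneg k]
  have hφ' : ∀ i, (φ i : Series) ∈ filt t (k + (t i + 1)) := fun i =>
    filt_mono (by linarith) (coe_mem_filt (apply_mem_P hφ i))
  have hv' := coe_mem_filt hv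
  have hW' : ∀ i, (W i : Series) ∈ filt t (n + k + 1 + t i) := fun i =>
    coe_mem_filt (apply_mem_P hW i)
  refine ⟨⟨fun i => s.Φ i - (φ i : Series), s.u + v, fun i => s.G i + (W i : Series),
    fun i => ?_, ?_, fun i => ?_, fun i => ?_⟩, W, hW, hNF, fun i => ?_, ?_, fun i => rfl⟩
  · convert! sub_mem (s.Φ_sub_mem i) (filt_mono (by linarith) (hφ' i)) using 1
    ring
  · convert! add_mem s.u_sub_mem (filt_mono hk hv') using 1
    ring
  · convert! add_mem (s.G_sub_mem i) (filt_mono (by linarith) (hW' i)) using 1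
    ring
  · convert! add_mem (defect_correction_mem ht hFn hF s hφ hv hW i)
      (filt_mono (by push_cast; linarith) (hR' i)) using 1
    ring
  · simpa using hφ' i
  · simpa using hv'

/-- The initial approximation. -/
def ApproxSolution.init (hF : ∀ i, F i - (Fn i : Series) ∈ filt t (n + t i + 1)) :
    ApproxSolution t n F Fn 0 where
  Φ := MvPowerSeries.X
  u := 1
  G i := Fn i
  Φ_sub_mem i := by simp [zero_mem]
  u_sub_mem := by simp [zero_mem]
  G_sub_mem i := by simp [zero_mem]
  defect_mem i := by
    simpa [defect, MvPowerSeries.subst_self, MvPowerSeries.pderiv_X, Pi.single_apply] using hF i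

/-- Solutions up to every degree that converge solve the equation. -/
lemma defect_limit_mem (ht : ∀ i, 0 < t i) (hFn : Fn ∈ Q t n)
    (hF : ∀ i, F i - (Fn i : Series) ∈ filt t (n + t i + 1)) {k : ℕ}
    (s : ApproxSolution t n F Fn k) {Φ : Fin 2 → Series} {u : Series} {G : FormalVF}
    (hΦ : ∀ i, Φ i - s.Φ i ∈ filt t (k + (t i + 1))) (hu : u - s.u ∈ filt t (k + 1))
    (hG : ∀ i, G i - s.G i ∈ filt t (k + (n + t i + 1))) (i : Fin 2) :
    defect F Φ u G i ∈ filt t (k + (n + t i + 1)) := by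
  have hk := Int.natCast_nonneg k
  have hF' : ∀ j, F j ∈ filt t (n + t j) := fun j =>
    mem_filt_of_sub_coe (apply_mem_P hFn j) (hF j)
  have hGs := mem_filt_of_sub_coe (apply_mem_P hFn i) (s.G_sub_mem i)
  have hba : ∀ i, Φ i - s.Φ i ∈ filt t (t i + (k + 1)) := fun i =>
    filt_mono (by linarith) (hΦ i)
  have hX : ∀ i, Φ i - MvPowerSeries.X i ∈ filt t (t i + 1) := fun i => by
    simpa using add_mem (filt_mono (by linarith) (hΦ i)) (s.Φ_sub_mem i)
  have hs := hasSubst_of_mem_filt ht (mem_filt_of_sub_X hX)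
  have hss := hasSubst_of_mem_filt ht (mem_filt_of_sub_X s.Φ_sub_mem)
  have hu0 : s.u ∈ filt t 0 := by
    simpa using add_mem (filt_mono zero_le_one s.u_sub_mem) one_mem_filt
  have hu1 : u ∈ filt t 0 := mem_filt_of_nonpos le_rfl u
  have h1 : ∑ j, MvPowerSeries.pderiv ℝ j (Φ i - s.Φ i) * F j ∈ filt t (k + (n + t i + 1)) :=
    (filt t _).sum_mem fun j _ => mul_mem_filt
      (pderiv_mem_filt j (hΦ i) (sub_add_cancel _ (t j : ℤ)).le) (hF' j) (by linarith)
  have h2 := mul_mem_filt hu (subst_mem_filt hss (mem_filt_of_sub_X s.Φ_sub_mem) hGs)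
    (c := k + (n + t i + 1)) (by linarith)
  have h3 := mul_mem_filt hu1 (subst_sub_subst_mem_filt ht s.Φ_sub_mem hba (by linarith) hGs)
    (c := k + (n + t i + 1)) (by linarith)
  have h4 := mul_mem_filt hu1 (subst_mem_filt hs (mem_filt_of_sub_X hX) (hG i))
    (c := k + (n + t i + 1)) (by linarith)
  convert! sub_mem (add_mem (s.defect_mem i) h1) (add_mem (add_mem h2 h3) h4) using 1
  rw [MvPowerSeries.subst_sub hs]
  simp only [defect, Fin.sum_univ_two, map_sub]
  ring

/-- For unequal weights `Φ` may have a linear part other than the identity, but `∂ⱼΦᵢ(0)` is free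
only when `t j > t i`: the matrix is triangular with unit diagonal. -/
lemma det_linear_part (Φ : Fin 2 → Series)
    (hΦ : ∀ i, Φ i - MvPowerSeries.X i ∈ filt t (t i + 1)) :
    (Matrix.of fun i j : Fin 2 => MvPowerSeries.coeff (Finsupp.single j 1) (Φ i)).det = 1 := by
  have h : ∀ i j : Fin 2, t j ≤ t i → MvPowerSeries.coeff (Finsupp.single j 1) (Φ i) =
      if i = j then 1 else 0 := by
    intro i j hij
    have h1 := hΦ i (Finsupp.single j 1) (by rw [deg_single]; omega)
    rw [map_sub, sub_eq_zero] at h1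
    rw [h1, MvPowerSeries.coeff_X]
    simp [Finsupp.single_left_inj, eq_comm]
  rw [Matrix.det_fin_two]
  simp only [Matrix.of_apply]
  rw [h 0 0 le_rfl, h 1 1 le_rfl]
  rcases le_total (t 0) (t 1) with h1 | h1
  · rw [h 1 0 h1]; simp
  · rw [h 0 1 h1]; simp

lemma sub_mem_of_isExpansion {Fj : ∀ j : ℤ, Q t j} (hF : IsExpansion n F Fj) (i : Fin 2) :
    F i - (((Fj n : PolyVF) i : Poly) : Series) ∈ filt t (n + t i + 1) := by
  intro d hd
  have h := (MvPowerSeries.WithPiTopology.hasSum_iff_hasSum_coeff.1 (hF i)) d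
  rw [map_sub, sub_eq_zero]
  refine h.unique (hasSum_single (⟨n, le_rfl⟩ : {j : ℤ // n ≤ j}) fun j hj => ?_)
  refine coe_mem_filt (apply_mem_P (Fj j).2 i) d ?_
  have : (j : ℤ) ≠ n := fun h => hj (Subtype.ext h)
  have := j.2
  omega

lemma isExpansion_of_forall {G : FormalVF} {Gj : ∀ j : ℤ, Q t j}
    (h : ∀ (k : ℕ) i,
      G i - ∑ l ∈ Finset.range (k + 1), (((Gj (n + l) : PolyVF) i : Poly) : Series) ∈
        filt t (k + (n + t i + 1))) : IsExpansion n G Gj := by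
  intro i
  refine MvPowerSeries.WithPiTopology.hasSum_iff_hasSum_coeff.2 fun d => ?_
  have hz : ∀ j : ℤ, deg t d ≠ j + t i →
      MvPowerSeries.coeff d (((Gj j : PolyVF) i : Poly) : Series) = 0 := by
    intro j hj
    rw [MvPolynomial.coeff_coe]
    by_contra hne
    exact hj (apply_mem_P (Gj j).2 i hne)
  -- Only the term of degree `deg t d - t i` can contribute at `d`; `k` is its position in the sum,
  -- or `0` when that degree is below `n` and nothing contributes.
  let k := (deg t d - t i - n).toNat
  have hk := h k i d (by omega)
  rw [map_sub, sub_eq_zero, map_sum] at hk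
  rw [hk]
  by_cases hd : n + t i ≤ deg t d
  · have hkd : n + (k : ℤ) + t i = deg t d := by omega
    rw [Finset.sum_eq_single_of_mem k (by simp) fun l _ hl => hz _ (by omega)]
    exact hasSum_single (⟨n + k, by omega⟩ : {j : ℤ // n ≤ j}) fun j hj => hz _ fun h => hj
      (Subtype.ext (by simp; omega))
  · rw [Finset.sum_eq_zero fun l _ => hz _ (by omega)]
    convert! hasSum_zero with j
    have := j.2
    exact hz _ (by omega)

/-- If the homological equation is solvable in every degree, then the field is formally orbitally
equivalent to a field in normal form. -/
theorem exists_normalForm (ht : ∀ i, 0 < t i) {Fj : ∀ j : ℤ, Q t j} (hF : IsExpansion n F Fj)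
    {NF : ℤ → PolyVF → Prop}
    (hsol : ∀ j k : ℤ, n + k = j → ∀ V ∈ Q t j, ∃ φ ∈ Q t k, ∃ v ∈ P t k, ∃ W ∈ Q t j,
      NF j W ∧ V = bracket φ (Fj n) + v • (Fj n : PolyVF) + W) :
    ∃ (G : FormalVF) (Gj : ∀ j : ℤ, Q t j), IsExpansion n G Gj ∧ Gj n = Fj n ∧
      (∀ j : ℤ, n < j → NF j (Gj j)) ∧ OrbitallyEquivalent F G := by
  have hF' := sub_mem_of_isExpansion hF
  choose next W hWQ hNF hΦ hu hG using
    fun (k : ℕ) (s : ApproxSolution t n F (Fj n) k) => exists_next ht (Fj n).2 hF' hsol s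
  let s : ∀ k : ℕ, ApproxSolution t n F (Fj n) k :=
    fun k => Nat.rec (ApproxSolution.init hF') next k
  have hs : ∀ k, s (k + 1) = next k (s k) := fun _ => rfl
  -- Later steps leave lower degrees of `G` untouched, so `G_{n+k+1}` is the field `W` added at step
  -- `k`.
  have hGj : ∀ j : ℤ, ∃ V : Q t j, (j = n → (V : PolyVF) = Fj n) ∧
      ∀ k : ℕ, j = n + k + 1 → (V : PolyVF) = W k (s k) := by
    intro j
    rcases lt_trichotomy j n with h | rfl | h
    · exact ⟨0, by omega, by omega⟩
    · exact ⟨Fj j, fun _ => rfl, by omega⟩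
    · obtain ⟨k, rfl⟩ : ∃ k : ℕ, j = n + k + 1 := ⟨(j - n - 1).toNat, by omega⟩
      refine ⟨⟨W k (s k), hWQ k (s k)⟩, by omega, fun l hl => ?_⟩
      obtain rfl : k = l := by omega
      rfl
  choose Gj hGn hGk using hGj
  have hsG : ∀ (k : ℕ) i, (s k).G i =
      ∑ l ∈ Finset.range (k + 1), (((Gj (n + l) : PolyVF) i : Poly) : Series) := by
    intro k i
    induction k with
    | zero =>
      rw [Finset.sum_range_one, hGn _ (by simp)]
      rfl
    | succ k ih => rw [Finset.sum_range_succ, ← ih, hs, hG, hGk _ k (by push_cast; ring)]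
  choose Φ hΦ' using fun i => exists_limit (f := fun k => (s k).Φ i) (c := t i + 1)
    fun k => hΦ k (s k) i
  obtain ⟨u, hu'⟩ := exists_limit (f := fun k => (s k).u) (c := 1) fun k => hu k (s k)
  choose G hG' using fun i => exists_limit (t := t) (f := fun k => (s k).G i)
    (c := n + t i + 1) fun k => by
      rw [hs, hG, add_sub_cancel_left]
      exact filt_mono (by linarith) (coe_mem_filt (apply_mem_P (hWQ k (s k)) i))
  have hX : ∀ i, Φ i - MvPowerSeries.X i ∈ filt t (t i + 1) := fun i => by
    simpa using add_mem (filt_mono (by simp) (hΦ' i 0)) ((s 0).Φ_sub_mem i)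
  refine ⟨G, Gj, isExpansion_of_forall fun k i => hsG k i ▸ hG' i k, Subtype.ext (hGn n rfl),
    fun j hj => ?_, Φ, u, fun i => ?_, ?_, ?_, fun i => ?_⟩
  · obtain ⟨k, rfl⟩ : ∃ k : ℕ, j = n + k + 1 := ⟨(j - n - 1).toNat, by omega⟩
    rw [hGk _ k rfl]
    exact hNF k (s k)
  · exact constantCoeff_eq_zero (by exact_mod_cast ht i) (mem_filt_of_sub_X hX i)
  · rw [det_linear_part Φ hX]
    exact one_ne_zero
  · have h : u - 1 ∈ filt t 1 := by
      simpa using add_mem (filt_mono (by simp) (hu' 0)) (s 0).u_sub_mem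
    have h0 := constantCoeff_eq_zero one_pos h
    rw [map_sub, map_one, sub_eq_zero] at h0
    rw [h0]
    exact one_pos
  · exact sub_eq_zero.1 (eq_zero_of_forall_mem_filt (c := n + t i + 1) fun k =>
      defect_limit_mem ht (Fj n).2 hF' (s k) (fun i => hΦ' i k) (hu' k) (fun i => hG' i k) i)

end solution

end QHNormalForm

end

theorem mainTheorem7 (t : Fin 2 → ℕ) (ht : ∀ i, 0 < t i) (n : ℤ)
    (F : QHNormalForm.FormalVF) (Fj : ∀ j : ℤ, QHNormalForm.Q t j)
    (hF : QHNormalForm.IsExpansion n F Fj)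
    (Δ : ∀ m : ℤ, Submodule ℝ (QHNormalForm.P t m))
    (hΔ : ∀ m, IsCompl (Δ m) (QHNormalForm.hMultiples (Fj n) m))
    (hker : ∀ k : ℕ, 1 ≤ k →
      LinearMap.ker (QHNormalForm.ellc (Fj n) Δ hΔ (n + k + QHNormalForm.wt t)) = ⊥)
    (Cor : ∀ k : ℤ, Submodule ℝ (QHNormalForm.P t k))
    (hCor : ∀ k, IsCompl (Cor k) (LinearMap.range (QHNormalForm.ell (Fj n) k)))
    (Corc : ∀ m : ℤ, Submodule ℝ (Δ m))
    (hCorc : ∀ m, IsCompl (Corc m) (LinearMap.range (QHNormalForm.ellc (Fj n) Δ hΔ m))) :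
    ∃ (G : QHNormalForm.FormalVF) (Gj : ∀ j : ℤ, QHNormalForm.Q t j),
      QHNormalForm.IsExpansion n G Gj ∧
      Gj n = Fj n ∧
      (∀ j : ℤ, n < j → ∃ g ∈ Corc (j + QHNormalForm.wt t), ∃ η ∈ Cor j,
        (Gj j : QHNormalForm.PolyVF) =
          QHNormalForm.ham (g : QHNormalForm.P t (j + QHNormalForm.wt t)) +
            (η : QHNormalForm.Poly) • QHNormalForm.D0 t) ∧
      QHNormalForm.OrbitallyEquivalent F G := by
  -- The recursion needs only that each degree is solvable modulo some class of fields; here the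
  -- class is `X_g + η D₀` with `g`, `η` in the chosen complements.
  exact QHNormalForm.exists_normalForm ht hF
    (NF := fun j V => ∃ g ∈ Corc (j + QHNormalForm.wt t), ∃ η ∈ Cor j,
      V = QHNormalForm.ham (g : QHNormalForm.P t (j + QHNormalForm.wt t)) +
        (η : QHNormalForm.Poly) • QHNormalForm.D0 t)
    fun j k hjk V hV => by
      obtain ⟨φ, hφ, v, hv, c, hc, η, hη, h⟩ :=
        QHNormalForm.exists_homological_solution ht (Fj n) Δ hΔ Cor hCor Corc hCorc hjk hV
      have hc' := QHNormalForm.ham_mem_Q (k := j)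
        (c : QHNormalForm.P t (j + QHNormalForm.wt t)).2 rfl
      have hη' := QHNormalForm.smul_mem_Q (η : QHNormalForm.P t j).2
        (QHNormalForm.D0_mem_Q (t := t)) (add_zero j)
      exact ⟨φ, hφ, v, hv, _, Submodule.add_mem _ hc' hη', ⟨c, hc, η, hη, rfl⟩, h⟩
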